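/- Let $T$ be the right shift on $\ell^2(\mathbb{Z}_+)$, $Te_n=e_{n+1}$, and let the Toeplitz algebra $\mathcal{T}$ be the norm closed subalgebra of $\mathcal{B}(\ell^2(\mathbb{Z}_+))$ generated by $T$ and $T^*$. Let $\mathcal{T}\otimes\mathcal{T}$ be the minimal $C^*$-tensor product, and let $\Delta\colon\mathcal{T}\to\mathcal{T}\otimes\mathcal{T}$ be the unique unital $*$-homomorphism with $\Delta(T)=T\otimes T$. Let $\mathcal{T}^*$ be the Banach space of all continuous linear functionals on $\mathcal{T}$, with the dual norm $\|\rho\|=\sup_{\|A\|\le 1}|\rho(A)|$. For $\rho,\varphi\in\mathcal{T}^*$ let $\rho\otimes\varphi$ be the unique continuous linear functional on $\mathcal{T}\otimes\mathcal{T}$ with $(\rho\otimes\varphi)(A\otimes B)=\rho(A)\varphi(B)$ for all $A,B\in\mathcal{T}$, and define $\rho\ast\varphi\in\mathcal{T}^*$ by $$(\rho\ast\varphi)(A)=(\rho\otimes\varphi)(\Delta(A)),\qquad A\in\mathcal{T}.$$ Then $\mathcal{T}^*$ with the product $\ast$ is a commutative Banach algebra: it is complete, the product is bilinear, associative and commutative,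 and $\|\rho\ast\varphi\|\le\|\rho\|\,\|\varphi\|$ for all $\rho,\varphi\in\mathcal{T}^*$. -/

import Mathlib

open scoped TensorProduct

noncomputable section

namespace Toeplitz

/-- The Hilbert space of square summable complex sequences indexed by the natural numbers. -/
abbrev L2 : Type := lp (fun _ : ℕ => ℂ) 2

/-- The standard orthonormal basis vector with index `n`. -/
def e (n : ℕ) : L2 := lp.single 2 n 1

/-- The sequence `0, f 0, f 1, …`. -/
def shiftSeq (f : ℕ → ℂ) : ℕ → ℂ
  | 0 => 0
  | n + 1 => f n

theorem memℓp_shiftSeq (f : L2) : Memℓp (shiftSeq f) 2 := by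
  refine memℓp_gen ?_
  rw [← summable_nat_add_iff 1]
  exact (lp.memℓp f).summable (by norm_num)

/-- The right shift as a linear map. -/
def shiftLinear : L2 →ₗ[ℂ] L2 where
  toFun f := ⟨shiftSeq f, memℓp_shiftSeq f⟩
  map_add' f g := by
    refine lp.ext (funext fun n => ?_)
    cases n
    · exact (add_zero (0 : ℂ)).symm
    · rfl
  map_smul' c f := by
    refine lp.ext (funext fun n => ?_)
    cases n
    · exact (mul_zero c).symm
    · rfl

theorem inner_shiftLinear (f g : L2) : inner ℂ (shiftLinear f) (shiftLinear g) = inner ℂ f g := by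
  have hs := lp.summable_inner (𝕜 := ℂ) (shiftLinear f) (shiftLinear g)
  have h0 : (shiftLinear f : ℕ → ℂ) 0 = 0 := rfl
  have h1 := hs.tsum_eq_zero_add
  rw [h0, inner_zero_left, zero_add] at h1
  rw [lp.inner_eq_tsum, lp.inner_eq_tsum]
  exact h1

/-- The right shift operator `T` on `ℓ²`. -/
def shift : L2 →L[ℂ] L2 := (shiftLinear.isometryOfInner inner_shiftLinear).toContinuousLinearMap

theorem shift_e (n : ℕ) : shift (e n) = e (n + 1) := by
  refine lp.ext (funext fun m => ?_)
  cases m with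
  | zero =>
    have : (shift (e n) : ℕ → ℂ) 0 = 0 := rfl
    rw [this]
    simp [e]
  | succ m =>
    have : (shift (e n) : ℕ → ℂ) (m + 1) = (e n : ℕ → ℂ) m := rfl
    rw [this]
    simp [e, Pi.single_apply]

/-- The Toeplitz algebra: the norm closed subalgebra of the bounded operators on `ℓ²`
generated by `T` and `T*`. -/
def toeplitz : StarSubalgebra ℂ (L2 →L[ℂ] L2) := StarAlgebra.elemental ℂ shift

theorem isClosed_toeplitz : IsClosed (toeplitz : Set (L2 →L[ℂ] L2)) :=
  StarAlgebra.elemental.isClosed ℂ shift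

/-- The Toeplitz algebra as a type, with the C*-algebra structure (in particular the operator norm)
inherited from the bounded operators on `ℓ²`. -/
def Toep : Type := toeplitz

/-- The C*-algebra structure of a closed star subalgebra. -/
def Toep.cstarAlgebra : CStarAlgebra Toep :=
  StarSubalgebra.cstarAlgebra toeplitz (h_closed := isClosed_toeplitz)

instance : CStarAlgebra Toep := Toep.cstarAlgebra

/-- The inclusion of the Toeplitz algebra in the bounded operators on `ℓ²`. -/
def Toep.val : Toep →⋆ₐ[ℂ] (L2 →L[ℂ] L2) := toeplitz.subtype

theorem Toep.val_mem (A : Toep) : A.val ∈ toeplitz := Subtype.property (p := (· ∈ toeplitz)) A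

theorem Toep.norm_val (A : Toep) : ‖A.val‖ = ‖A‖ := rfl

/-- The shift as an element of the Toeplitz algebra. -/
def T : Toep := (⟨shift, StarAlgebra.elemental.self_mem ℂ shift⟩ : toeplitz)

/-- The Hilbert space tensor product of `ℓ²` with itself. -/
def L2L2 : Type := UniformSpace.Completion (L2 ⊗[ℂ] L2)

instance : NormedAddCommGroup L2L2 :=
  inferInstanceAs (NormedAddCommGroup (UniformSpace.Completion (L2 ⊗[ℂ] L2)))

instance : InnerProductSpace ℂ L2L2 :=
  inferInstanceAs (InnerProductSpace ℂ (UniformSpace.Completion (L2 ⊗[ℂ] L2)))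

instance : CompleteSpace L2L2 :=
  inferInstanceAs (CompleteSpace (UniformSpace.Completion (L2 ⊗[ℂ] L2)))

/-- The inclusion of the algebraic tensor product. -/
def ofAlg : L2 ⊗[ℂ] L2 →L[ℂ] L2L2 :=
  (UniformSpace.Completion.toComplL : L2 ⊗[ℂ] L2 →L[ℂ] UniformSpace.Completion (L2 ⊗[ℂ] L2))

/-- The bounded operator `A ⊗ B` on the Hilbert space tensor product. -/
def opTensor (A B : L2 →L[ℂ] L2) : L2L2 →L[ℂ] L2L2 := (TensorProduct.mapL A B).completion

/-- The minimal (spatial) C*-tensor product of the Toeplitz algebra with itself: the norm closed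
star subalgebra of the bounded operators on the Hilbert space tensor product that is generated by
the operators `A ⊗ B` with `A` and `B` in the Toeplitz algebra. -/
def minTensor : StarSubalgebra ℂ (L2L2 →L[ℂ] L2L2) :=
  (StarAlgebra.adjoin ℂ {X | ∃ A ∈ toeplitz, ∃ B ∈ toeplitz, X = opTensor A B}).topologicalClosure

theorem isClosed_minTensor : IsClosed (minTensor : Set (L2L2 →L[ℂ] L2L2)) :=
  StarSubalgebra.isClosed_topologicalClosure _

/-- The minimal tensor product as a type, with the C*-algebra structure inherited from the bounded
operators on the Hilbert space tensor product. -/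
def MinTensor : Type := minTensor

/-- The C*-algebra structure of a closed star subalgebra. -/
def MinTensor.cstarAlgebra : CStarAlgebra MinTensor :=
  StarSubalgebra.cstarAlgebra minTensor (h_closed := isClosed_minTensor)

instance : CStarAlgebra MinTensor := MinTensor.cstarAlgebra

/-- The inclusion of the minimal tensor product in the bounded operators. -/
def MinTensor.val : MinTensor →⋆ₐ[ℂ] (L2L2 →L[ℂ] L2L2) := minTensor.subtype

theorem MinTensor.norm_val (X : MinTensor) : ‖X.val‖ = ‖X‖ := rfl

theorem MinTensor.val_ext {X Y : MinTensor} (h : X.val = Y.val) : X = Y :=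
  Subtype.ext (p := (· ∈ minTensor)) h

/-- The elementary tensor `A ⊗ B` as an element of the minimal tensor product. -/
def tmul (A B : Toep) : MinTensor :=
  (⟨opTensor A.val B.val, StarSubalgebra.le_topologicalClosure _
    (StarAlgebra.subset_adjoin ℂ _ ⟨A.val, A.val_mem, B.val, B.val_mem, rfl⟩)⟩ : minTensor)

theorem val_tmul (A B : Toep) : (tmul A B).val = opTensor A.val B.val := rfl

/-! ### Auxiliary facts on the Hilbert space tensor product -/

/-- The vector `x ⊗ y`. -/
def vec (x y : L2) : L2L2 := ofAlg (x ⊗ₜ[ℂ] y)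

/-- The map `x ↦ x ⊗ y`. -/
def vecL (y : L2) : L2 →L[ℂ] L2L2 :=
  ofAlg ∘L (TensorProduct.mkL ℂ L2 L2).flip y

/-- The map `y ↦ x ⊗ y`. -/
def vecR (x : L2) : L2 →L[ℂ] L2L2 :=
  ofAlg ∘L (TensorProduct.mkL ℂ L2 L2) x

theorem vecL_apply (x y : L2) : vecL y x = vec x y := rfl

theorem vecR_apply (x y : L2) : vecR x y = vec x y := rfl

theorem inner_vec (a b c d : L2) :
    inner ℂ (vec a b) (vec c d) = inner ℂ a c * inner ℂ b d := by
  rw [← TensorProduct.inner_tmul]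
  exact UniformSpace.Completion.inner_coe (𝕜 := ℂ) _ _

theorem norm_vecL_le (y : L2) : ‖vecL y‖ ≤ ‖y‖ := by
  refine ContinuousLinearMap.opNorm_le_bound _ (norm_nonneg _) fun x => ?_
  rw [mul_comm, ← TensorProduct.norm_tmul (𝕜 := ℂ) x y]
  exact (UniformSpace.Completion.norm_coe (x ⊗ₜ[ℂ] y)).le

theorem opTensor_vec (A B : L2 →L[ℂ] L2) (x y : L2) :
    opTensor A B (vec x y) = vec (A x) (B y) := by
  exact ContinuousLinearMap.completion_apply_coe (TensorProduct.mapL A B) (x ⊗ₜ[ℂ] y)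

theorem ext_vec {E : Type*} [NormedAddCommGroup E] [NormedSpace ℂ E] {f g : L2L2 →L[ℂ] E}
    (h : ∀ x y, f (vec x y) = g (vec x y)) : f = g := by
  refine ContinuousLinearMap.ext fun z => ?_
  induction z using UniformSpace.Completion.induction_on with
  | hp => exact isClosed_eq f.continuous g.continuous
  | ih z =>
    change f (ofAlg z) = g (ofAlg z)
    induction z using TensorProduct.induction_on with
    | zero => simp only [map_zero]
    | tmul x y => exact h x y
    | add a b ha hb => simp only [map_add, ha, hb]

theorem inner_e (m : ℕ) (f : L2) : inner ℂ (e m) f = f m := by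
  rw [e, lp.inner_single_left]
  simp

theorem ext_e {E : Type*} [NormedAddCommGroup E] [NormedSpace ℂ E] {f g : L2 →L[ℂ] E}
    (h : ∀ n, f (e n) = g (e n)) : f = g := by
  refine lp.ext_continuousLinearMap (by simp) fun n => ?_
  ext
  exact h n

theorem eq_zero_of_inner {z : L2L2} (h : ∀ i j, inner ℂ z (vec (e i) (e j)) = 0) : z = 0 := by
  have h1 : ∀ i y, inner ℂ z (vec (e i) y) = 0 := fun i y =>
    DFunLike.congr_fun (ext_e (f := innerSL ℂ z ∘L vecR (e i)) (g := 0) (h i)) y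
  have h2 : ∀ x y, inner ℂ z (vec x y) = 0 := fun x y =>
    DFunLike.congr_fun (ext_e (f := innerSL ℂ z ∘L vecL y) (g := 0) (fun i => h1 i y)) x
  have h3 := ext_vec (f := innerSL ℂ z) (g := 0) h2
  exact inner_self_eq_zero (𝕜 := ℂ).1 (DFunLike.congr_fun h3 z)

theorem orthonormal_e : Orthonormal ℂ e := by
  classical
  rw [orthonormal_iff_ite]
  intro i j
  rw [inner_e]
  simp [e, Pi.single_apply]

theorem orthonormal_vec : Orthonormal ℂ (fun p : ℕ × ℕ => vec (e p.1) (e p.2)) := by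
  classical
  have h := orthonormal_iff_ite.1 orthonormal_e
  rw [orthonormal_iff_ite]
  rintro ⟨i, j⟩ ⟨k, l⟩
  simp only [inner_vec, h, Prod.mk.injEq]
  by_cases hik : i = k <;> by_cases hjl : j = l <;> simp [hik, hjl]

theorem opTensor_mul (A B C D : L2 →L[ℂ] L2) :
    opTensor (A * C) (B * D) = opTensor A B * opTensor C D :=
  ext_vec fun x y => by
    simp only [mul_apply_eq_comp, opTensor_vec]

theorem opTensor_one : opTensor 1 1 = 1 :=
  ext_vec fun x y => by
    simp only [one_apply_eq_self, opTensor_vec]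

theorem opTensor_star (A B : L2 →L[ℂ] L2) :
    star (opTensor A B) = opTensor (star A) (star B) := by
  refine ext_vec fun x y => ?_
  refine ext_inner_left ℂ fun z => ?_
  rw [ContinuousLinearMap.star_eq_adjoint, ContinuousLinearMap.adjoint_inner_right]
  have key : (innerSL ℂ (vec x y)) ∘L opTensor A B =
      innerSL ℂ (opTensor (star A) (star B) (vec x y)) := by
    refine ext_vec fun a b => ?_
    simp only [ContinuousLinearMap.comp_apply, innerSL_apply_apply, opTensor_vec, inner_vec,
      ContinuousLinearMap.star_eq_adjoint, ContinuousLinearMap.adjoint_inner_left]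
  have := DFunLike.congr_fun key z
  simp only [ContinuousLinearMap.comp_apply, innerSL_apply_apply] at this
  rw [← inner_conj_symm, this, inner_conj_symm]

theorem opTensor_add_left (A A' B : L2 →L[ℂ] L2) :
    opTensor (A + A') B = opTensor A B + opTensor A' B :=
  ext_vec fun x y => by
    simp only [add_apply, opTensor_vec]
    exact map_add (vecL _) _ _

theorem opTensor_add_right (A B B' : L2 →L[ℂ] L2) :
    opTensor A (B + B') = opTensor A B + opTensor A B' :=
  ext_vec fun x y => by
    simp only [add_apply, opTensor_vec]
    exact map_add (vecR _) _ _

theorem opTensor_smul_left (c : ℂ) (A B : L2 →L[ℂ] L2) :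
    opTensor (c • A) B = c • opTensor A B :=
  ext_vec fun x y => by
    simp only [smul_apply, opTensor_vec]
    exact map_smul (vecL _) _ _

theorem opTensor_smul_right (c : ℂ) (A B : L2 →L[ℂ] L2) :
    opTensor A (c • B) = c • opTensor A B :=
  ext_vec fun x y => by
    simp only [smul_apply, opTensor_vec]
    exact map_smul (vecR _) _ _

/-! ### Existence and uniqueness of the comultiplication -/

/-- The star homomorphism `A ↦ A ⊗ 1`. -/
def ampliation : (L2 →L[ℂ] L2) →⋆ₐ[ℂ] (L2L2 →L[ℂ] L2L2) where
  toFun A := opTensor A 1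
  map_one' := opTensor_one
  map_mul' A B := by rw [← opTensor_mul, one_mul]
  map_zero' := by simpa using opTensor_smul_left 0 0 1
  map_add' A B := opTensor_add_left A B 1
  commutes' c := by
    rw [Algebra.algebraMap_eq_smul_one, Algebra.algebraMap_eq_smul_one, opTensor_smul_left,
      opTensor_one]
  map_star' A := by rw [opTensor_star, star_one]

/-- The bijection of pairs that keeps the minimum and encodes the difference. -/
def sigma (p : ℕ × ℕ) : ℕ × ℕ :=
  (min p.1 p.2, if p.2 ≤ p.1 then 2 * (p.1 - p.2) else 2 * (p.2 - p.1) - 1)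

theorem sigma_injective : Function.Injective sigma := by
  rintro ⟨a, b⟩ ⟨c, d⟩ h
  simp only [sigma, Prod.mk.injEq] at h ⊢
  split_ifs at h <;> omega

theorem sigma_surjective : Function.Surjective sigma := by
  rintro ⟨m, k⟩
  rcases Nat.even_or_odd' k with ⟨r, rfl | rfl⟩
  · refine ⟨(m + r, m), ?_⟩
    simp [sigma]
  · refine ⟨(m, m + r + 1), ?_⟩
    simp only [sigma, Prod.mk.injEq]
    split_ifs <;> omega

theorem sigma_succ (i j : ℕ) : sigma (i + 1, j + 1) = ((sigma (i, j)).1 + 1, (sigma (i, j)).2) := by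
  simp only [sigma, Prod.mk.injEq]
  split_ifs <;> omega

theorem exists_unitary : ∃ J : L2L2 ≃ₗᵢ[ℂ] L2L2, ∀ i j,
    J (vec (e i) (e j)) = vec (e (sigma (i, j)).1) (e (sigma (i, j)).2) := by
  classical
  have hs := sigma_surjective
  let b : HilbertBasis (ℕ × ℕ) ℂ L2L2 := HilbertBasis.mkOfOrthogonalEqBot orthonormal_vec (by
    rw [Submodule.eq_bot_iff]
    intro z hz
    exact eq_zero_of_inner fun i j =>
      (Submodule.mem_orthogonal' _ _).1 hz _ (Submodule.subset_span ⟨(i, j), rfl⟩))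
  let b' : HilbertBasis (ℕ × ℕ) ℂ L2L2 := HilbertBasis.mkOfOrthogonalEqBot
    (orthonormal_vec.comp sigma sigma_injective) (by
      rw [Submodule.eq_bot_iff]
      intro z hz
      refine eq_zero_of_inner fun i j => ?_
      obtain ⟨q, hq⟩ := hs (i, j)
      refine (Submodule.mem_orthogonal' _ _).1 hz _ (Submodule.subset_span ⟨q, ?_⟩)
      simp [hq])
  refine ⟨b.repr.trans b'.repr.symm, fun i j => ?_⟩
  have hb : b (i, j) = vec (e i) (e j) := by
    simp only [b, HilbertBasis.coe_mkOfOrthogonalEqBot]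
  have hb' : b' (i, j) = vec (e (sigma (i, j)).1) (e (sigma (i, j)).2) := by
    simp only [b', HilbertBasis.coe_mkOfOrthogonalEqBot, Function.comp]
  rw [← hb, ← hb', LinearIsometryEquiv.trans_apply, HilbertBasis.repr_self,
    HilbertBasis.repr_symm_single]

theorem continuous_starAlgHom (Δ : Toep →⋆ₐ[ℂ] MinTensor) : Continuous Δ := by
  refine AddMonoidHomClass.continuous_of_bound Δ 1 fun x => ?_
  rw [one_mul]
  exact NonUnitalStarAlgHom.norm_apply_le Δ x

/-- There is exactly one unital star homomorphism from the Toeplitz algebra to the minimal tensor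
product that maps `T` to `T ⊗ T`. -/
theorem existsUnique_comul : ∃! Δ : Toep →⋆ₐ[ℂ] MinTensor, Δ T = tmul T T := by
  obtain ⟨J, hJ⟩ := exists_unitary
  let Φ : (L2 →L[ℂ] L2) →⋆ₐ[ℂ] (L2L2 →L[ℂ] L2L2) :=
    (StarAlgEquiv.toStarAlgHom J.symm.conjStarAlgEquiv).comp ampliation
  have hΦ : Φ shift = opTensor shift shift := by
    refine ext_vec fun x y => ?_
    have h1 : ∀ i j, Φ shift (vec (e i) (e j)) = opTensor shift shift (vec (e i) (e j)) := by
      intro i j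
      change J.symm (opTensor shift 1 (J.symm.symm (vec (e i) (e j)))) = _
      rw [LinearIsometryEquiv.symm_symm, LinearIsometryEquiv.symm_apply_eq, hJ, opTensor_vec,
        opTensor_vec, shift_e, shift_e, shift_e, hJ, sigma_succ]
      rfl
    have h2 : ∀ i y, Φ shift (vec (e i) y) = opTensor shift shift (vec (e i) y) := fun i y =>
      DFunLike.congr_fun (ext_e (f := Φ shift ∘L vecR (e i))
        (g := opTensor shift shift ∘L vecR (e i)) (h1 i)) y
    exact DFunLike.congr_fun (ext_e (f := Φ shift ∘L vecL y)
      (g := opTensor shift shift ∘L vecL y) (fun i => h2 i y)) x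
  have hc : Continuous Φ := map_continuous Φ
  have hle : toeplitz ≤ minTensor.comap Φ := by
    refine StarAlgebra.elemental.le_of_mem (isClosed_minTensor.preimage hc) ?_
    change Φ shift ∈ minTensor
    rw [hΦ]
    exact (tmul T T).2
  refine ⟨(Φ.comp toeplitz.subtype).codRestrict minTensor fun A => hle A.2,
    Subtype.ext hΦ, fun Ψ hΨ => ?_⟩
  refine StarAlgebra.elemental.starAlgHomClass_ext ℂ (continuous_starAlgHom Ψ)
    (continuous_starAlgHom _) ?_
  exact hΨ.trans (Subtype.ext hΦ.symm)

/-- The comultiplication of the Toeplitz algebra: the unique unital star homomorphism `Δ` from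
the Toeplitz algebra to its minimal tensor square with `Δ T = T ⊗ T`. -/
def comul : Toep →⋆ₐ[ℂ] MinTensor := Classical.choose existsUnique_comul

theorem comul_T : comul T = tmul T T := (Classical.choose_spec existsUnique_comul).1

theorem continuous_comul : Continuous comul := continuous_starAlgHom comul

/-! ### Existence and uniqueness of the tensor product of functionals -/

/-- The canonical linear map from the algebraic to the minimal tensor product. -/
def ofAlgTensor : Toep ⊗[ℂ] Toep →ₗ[ℂ] MinTensor :=
  TensorProduct.lift (LinearMap.mk₂ ℂ tmul
    (fun A A' B => MinTensor.val_ext (opTensor_add_left A.val A'.val B.val))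
    (fun c A B => MinTensor.val_ext (opTensor_smul_left c A.val B.val))
    (fun A B B' => MinTensor.val_ext (opTensor_add_right A.val B.val B'.val))
    (fun c A B => MinTensor.val_ext (opTensor_smul_right c A.val B.val)))

theorem ofAlgTensor_tmul (A B : Toep) : ofAlgTensor (A ⊗ₜ B) = tmul A B := rfl

theorem exists_ofAlgTensor_mul (x y : Toep ⊗[ℂ] Toep) :
    ∃ z, (ofAlgTensor z).val =
      (ofAlgTensor x).val * (ofAlgTensor y).val := by
  induction x using TensorProduct.induction_on with
  | zero => exact ⟨0, by rw [map_zero, map_zero, zero_mul]⟩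
  | add a b ha hb =>
    obtain ⟨a', ha'⟩ := ha
    obtain ⟨b', hb'⟩ := hb
    exact ⟨a' + b', by
        rw [map_add, map_add, map_add, map_add, ha', hb']
        exact (ContinuousLinearMap.add_comp _ _ _).symm⟩
  | tmul A B =>
    induction y using TensorProduct.induction_on with
    | zero => exact ⟨0, by rw [map_zero, map_zero, mul_zero]⟩
    | add a b ha hb =>
      obtain ⟨a', ha'⟩ := ha
      obtain ⟨b', hb'⟩ := hb
      exact ⟨a' + b', by
        rw [map_add, map_add, map_add, map_add, ha', hb', mul_add]⟩
    | tmul C D => exact ⟨(A * C) ⊗ₜ (B * D), opTensor_mul _ _ _ _⟩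

theorem exists_ofAlgTensor_star (x : Toep ⊗[ℂ] Toep) :
    ∃ y, ofAlgTensor y = star (ofAlgTensor x) := by
  induction x using TensorProduct.induction_on with
  | zero => exact ⟨0, by simp⟩
  | add a b ha hb =>
    obtain ⟨a', ha'⟩ := ha
    obtain ⟨b', hb'⟩ := hb
    exact ⟨a' + b', by rw [map_add, map_add, ha', hb', star_add]⟩
  | tmul A B => exact ⟨star A ⊗ₜ star B, MinTensor.val_ext (opTensor_star _ _).symm⟩

theorem denseRange_ofAlgTensor : DenseRange ofAlgTensor := by
  have h : ∀ X ∈ StarAlgebra.adjoin ℂ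
      {X | ∃ A ∈ toeplitz, ∃ B ∈ toeplitz, X = opTensor A B},
      ∃ x, (ofAlgTensor x).val = X := by
    intro X hX
    induction hX using StarAlgebra.adjoin_induction with
    | mem X hX =>
      obtain ⟨A, hA, B, hB, rfl⟩ := hX
      exact ⟨(⟨A, hA⟩ : toeplitz) ⊗ₜ[ℂ] (⟨B, hB⟩ : toeplitz), rfl⟩
    | algebraMap c =>
      refine ⟨c • (1 ⊗ₜ 1), ?_⟩
      rw [map_smul, Algebra.algebraMap_eq_smul_one]
      exact congrArg (c • ·) opTensor_one
    | add X Y _ _ hX hY =>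
      obtain ⟨x, rfl⟩ := hX
      obtain ⟨y, rfl⟩ := hY
      exact ⟨x + y, by rw [map_add]; rfl⟩
    | mul X Y _ _ hX hY =>
      obtain ⟨x, rfl⟩ := hX
      obtain ⟨y, rfl⟩ := hY
      obtain ⟨z, hz⟩ := exists_ofAlgTensor_mul x y
      exact ⟨z, hz⟩
    | star X _ hX =>
      obtain ⟨x, rfl⟩ := hX
      obtain ⟨y, hy⟩ := exists_ofAlgTensor_star x
      exact ⟨y, by rw [hy]; rfl⟩
  intro X
  refine (closure_subtype (p := (· ∈ minTensor))).2 ?_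
  refine closure_mono ?_ X.2
  intro Y hY
  obtain ⟨x, rfl⟩ := h Y hY
  exact ⟨_, ⟨x, rfl⟩, rfl⟩

/-- The algebraic tensor product of two functionals. -/
def algFunctional (ρ φ : StrongDual ℂ Toep) : Toep ⊗[ℂ] Toep →ₗ[ℂ] ℂ :=
  LinearMap.mul' ℂ ℂ ∘ₗ TensorProduct.map (ρ : Toep →ₗ[ℂ] ℂ) (φ : Toep →ₗ[ℂ] ℂ)

/-- The functional `ω B = ⟪η, B ξ⟫`. -/
def vectorFunctional (ξ η : L2) : Toep →ₗ[ℂ] ℂ where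
  toFun B := inner ℂ η (B.val ξ)
  map_add' _ _ := inner_add_right _ _ _
  map_smul' _ _ := inner_smul_right _ _ _

/-- The slice map `ρ ⊗ id` on the algebraic tensor product. -/
def sliceLeft (ρ : Toep →ₗ[ℂ] ℂ) : Toep ⊗[ℂ] Toep →ₗ[ℂ] Toep :=
  (TensorProduct.lid ℂ Toep).toLinearMap ∘ₗ TensorProduct.map ρ LinearMap.id

/-- The slice map `id ⊗ ω` on the algebraic tensor product. -/
def sliceRight (ω : Toep →ₗ[ℂ] ℂ) : Toep ⊗[ℂ] Toep →ₗ[ℂ] Toep :=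
  (TensorProduct.rid ℂ Toep).toLinearMap ∘ₗ TensorProduct.map LinearMap.id ω

theorem coe_sliceRight (ξ η : L2) (x : Toep ⊗[ℂ] Toep) :
    (sliceRight (vectorFunctional ξ η) x).val =
      (vecL η).adjoint ∘L (ofAlgTensor x).val ∘L vecL ξ := by
  induction x using TensorProduct.induction_on with
  | zero => simp
  | add a b ha hb =>
    rw [map_add, map_add]
    simp only [map_add, ha, hb, ContinuousLinearMap.add_comp,
      ContinuousLinearMap.comp_add]
  | tmul A B =>
    refine ContinuousLinearMap.ext fun v => ext_inner_left ℂ fun u => ?_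
    have h1 : (sliceRight (vectorFunctional ξ η) (A ⊗ₜ B)).val v =
      inner ℂ η (B.val ξ) • A.val v := rfl
    have h2 : (ofAlgTensor (A ⊗ₜ B)).val = opTensor A.val B.val := rfl
    rw [h1, h2, ContinuousLinearMap.comp_apply, ContinuousLinearMap.adjoint_inner_right,
      ContinuousLinearMap.comp_apply, vecL_apply, vecL_apply, opTensor_vec, inner_vec,
      inner_smul_right, mul_comm]

theorem norm_sliceRight_le (ξ η : L2) (x : Toep ⊗[ℂ] Toep) :
    ‖sliceRight (vectorFunctional ξ η) x‖ ≤ ‖η‖ * ‖ξ‖ * ‖ofAlgTensor x‖ := by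
  have h : ‖(vecL η).adjoint‖ ≤ ‖η‖ := by
    rw [LinearIsometryEquiv.norm_map]
    exact norm_vecL_le η
  calc ‖sliceRight (vectorFunctional ξ η) x‖
      = ‖(vecL η).adjoint ∘L (ofAlgTensor x).val ∘L vecL ξ‖ := by
        rw [← coe_sliceRight]; rfl
    _ ≤ ‖(vecL η).adjoint‖ * (‖(ofAlgTensor x).val‖ * ‖vecL ξ‖) :=
        (ContinuousLinearMap.opNorm_comp_le _ _).trans (by
          gcongr
          exact ContinuousLinearMap.opNorm_comp_le _ _)
    _ ≤ ‖η‖ * (‖ofAlgTensor x‖ * ‖ξ‖) := by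
        gcongr
        · exact le_rfl
        · exact norm_vecL_le ξ
    _ = _ := by ring

theorem functional_sliceRight (ρ ω : Toep →ₗ[ℂ] ℂ) (x : Toep ⊗[ℂ] Toep) :
    ρ (sliceRight ω x) = ω (sliceLeft ρ x) := by
  induction x using TensorProduct.induction_on with
  | zero => simp
  | add a b ha hb => simp only [map_add, ha, hb]
  | tmul A B =>
    simp only [sliceRight, sliceLeft, LinearMap.comp_apply, TensorProduct.map_tmul,
      LinearMap.id_apply, LinearEquiv.coe_coe, TensorProduct.rid_tmul, TensorProduct.lid_tmul,
      map_smul, smul_eq_mul]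
    ring

theorem norm_sliceLeft_le (ρ : StrongDual ℂ Toep) (x : Toep ⊗[ℂ] Toep) :
    ‖sliceLeft (ρ : Toep →ₗ[ℂ] ℂ) x‖ ≤ ‖ρ‖ * ‖ofAlgTensor x‖ := by
  refine ContinuousLinearMap.opNorm_le_bound _ (by positivity) fun ξ => ?_
  generalize hD : (sliceLeft (ρ : Toep →ₗ[ℂ] ℂ) x).val = D
  change ‖(sliceLeft (ρ : Toep →ₗ[ℂ] ℂ) x).val ξ‖ ≤ _
  rw [hD]
  have h : ∀ η, ‖inner ℂ η (D ξ)‖ ≤ ‖ρ‖ * ‖ofAlgTensor x‖ * ‖ξ‖ * ‖η‖ := by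
    intro η
    rw [← hD]
    have h1 : inner ℂ η ((sliceLeft (ρ : Toep →ₗ[ℂ] ℂ) x).val ξ) = ρ (sliceRight (vectorFunctional ξ η) x) :=
      (functional_sliceRight (ρ : Toep →ₗ[ℂ] ℂ) (vectorFunctional ξ η) x).symm
    rw [h1]
    calc _ ≤ ‖ρ‖ * ‖sliceRight (vectorFunctional ξ η) x‖ := ρ.le_opNorm _
      _ ≤ ‖ρ‖ * (‖η‖ * ‖ξ‖ * ‖ofAlgTensor x‖) := by
        gcongr
        exact norm_sliceRight_le ξ η x
      _ = _ := by ring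
  have h2 := h (D ξ)
  rw [inner_self_eq_norm_sq_to_K] at h2
  rcases (norm_nonneg (D ξ)).eq_or_lt with h0 | h0
  · exact h0.symm.le.trans (by positivity)
  · refine le_of_mul_le_mul_right ?_ h0
    simpa [sq] using h2

theorem norm_algFunctional_le (ρ φ : StrongDual ℂ Toep) (x : Toep ⊗[ℂ] Toep) :
    ‖algFunctional ρ φ x‖ ≤ ‖ρ‖ * ‖φ‖ * ‖ofAlgTensor x‖ := by
  have h : algFunctional ρ φ x = φ (sliceLeft (ρ : Toep →ₗ[ℂ] ℂ) x) := by
    induction x using TensorProduct.induction_on with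
    | zero => simp
    | add a b ha hb => simp only [map_add, ha, hb]
    | tmul A B =>
      simp [sliceLeft, algFunctional]
  rw [h]
  calc _ ≤ ‖φ‖ * ‖sliceLeft (ρ : Toep →ₗ[ℂ] ℂ) x‖ := φ.le_opNorm _
    _ ≤ ‖φ‖ * (‖ρ‖ * ‖ofAlgTensor x‖) := by
      gcongr
      exact norm_sliceLeft_le ρ x
    _ = _ := by ring

/-- For two continuous functionals on the Toeplitz algebra there is exactly one continuous
functional on the minimal tensor product that maps `A ⊗ B` to `ρ A * φ B`. -/
theorem existsUnique_tensorFunctional (ρ φ : StrongDual ℂ Toep) :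
    ∃! F : StrongDual ℂ MinTensor, ∀ A B, F (tmul A B) = ρ A * φ B := by
  refine ⟨(algFunctional ρ φ).extendOfNorm ofAlgTensor, fun A B => ?_, fun F hF => ?_⟩
  · rw [← ofAlgTensor_tmul, LinearMap.extendOfNorm_eq denseRange_ofAlgTensor
      ⟨_, norm_algFunctional_le ρ φ⟩]
    rfl
  · refine (LinearMap.extendOfNorm_unique denseRange_ofAlgTensor _
      (norm_algFunctional_le ρ φ) F ?_).symm
    exact TensorProduct.ext' hF

/-- The functional `ρ ⊗ φ` on the minimal tensor product: the unique continuous functional with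
`(ρ ⊗ φ) (A ⊗ B) = ρ A * φ B`. -/
def tensorFunctional (ρ φ : StrongDual ℂ Toep) : StrongDual ℂ MinTensor :=
  Classical.choose (existsUnique_tensorFunctional ρ φ)

theorem tensorFunctional_tmul (ρ φ : StrongDual ℂ Toep) (A B : Toep) :
    tensorFunctional ρ φ (tmul A B) = ρ A * φ B :=
  (Classical.choose_spec (existsUnique_tensorFunctional ρ φ)).1 A B

/-- The product on the dual space: `(ρ ∗ φ) A = (ρ ⊗ φ) (Δ A)`. -/
def convolution (ρ φ : StrongDual ℂ Toep) : StrongDual ℂ Toep where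
  toFun A := tensorFunctional ρ φ (comul A)
  map_add' A B := by rw [map_add, map_add]
  map_smul' c A := by rw [map_smul, map_smul]; rfl
  cont := (tensorFunctional ρ φ).continuous.comp continuous_comul

end Toeplitz

/-- The operation `m` makes the complex normed space `E` a commutative Banach algebra, which need
not have a unit: `E` is complete, and `m` is bilinear, associative, commutative and
submultiplicative for the norm. -/
structure IsCommBanachAlgebra (E : Type*) [NormedAddCommGroup E] [NormedSpace ℂ E]
    (m : E → E → E) : Prop where
  complete : CompleteSpace E
  add_left : ∀ x y z, m (x + y) z = m x z + m y z
  add_right : ∀ x y z, m x (y + z) = m x y + m x z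
  smul_left : ∀ (c : ℂ) x y, m (c • x) y = c • m x y
  smul_right : ∀ (c : ℂ) x y, m x (c • y) = c • m x y
  assoc : ∀ x y z, m (m x y) z = m x (m y z)
  comm : ∀ x y, m x y = m y x
  norm_le : ∀ x y, ‖m x y‖ ≤ ‖x‖ * ‖y‖

end

/-!
Since `Δ` is a star homomorphism with `Δ T = T ⊗ T`, every word `A` in `T` and `T*` is group-like:
`Δ A = A ⊗ A`. On such elements the convolution of two functionals is their pointwise product, and
the words span a dense subspace. Restriction to the group-like elements therefore embeds the dual
space in a commutative algebra of functions, from which all the algebraic laws are inherited. The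
norm inequality holds because `ρ ⊗ φ` is bounded by `‖ρ‖ * ‖φ‖` for the spatial norm and `Δ` is
contractive.
-/

theorem IsCommBanachAlgebra.of_injective {E R : Type*} [NormedAddCommGroup E] [NormedSpace ℂ E]
    [CompleteSpace E] [NonUnitalCommSemiring R] [Module ℂ R] [IsScalarTower ℂ R R]
    {m : E → E → E} (f : E →ₗ[ℂ] R) (hf : Function.Injective f)
    (hmul : ∀ x y, f (m x y) = f x * f y) (hnorm : ∀ x y, ‖m x y‖ ≤ ‖x‖ * ‖y‖) :
    IsCommBanachAlgebra E m where
  complete := inferInstance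
  add_left x y z := hf <| by simp only [hmul, map_add, add_mul]
  add_right x y z := hf <| by simp only [hmul, map_add, mul_add]
  smul_left c x y := hf <| by simp only [hmul, map_smul, smul_mul_assoc]
  smul_right c x y := hf <| by simp only [hmul, map_smul, mul_comm (f x), smul_mul_assoc]
  assoc x y z := hf <| by simp only [hmul, mul_assoc]
  comm x y := hf <| by simp only [hmul, mul_comm]
  norm_le := hnorm

theorem coe_elemental_subset_closure_span {𝕜 A : Type*} [CommSemiring 𝕜] [StarRing 𝕜]
    [TopologicalSpace A] [Semiring A] [StarRing A] [IsTopologicalSemiring A] [ContinuousStar A]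
    [Algebra 𝕜 A] [StarModule 𝕜 A] {M : Submonoid A} {x : A} (hx : x ∈ M) (hx' : star x ∈ M) :
    (StarAlgebra.elemental 𝕜 x : Set A) ⊆ closure (Submodule.span 𝕜 (M : Set A)) := by
  have words_le : Submonoid.closure ({x} ∪ star {x}) ≤ M := by
    simp [Submonoid.closure_le, Set.star_singleton, Set.insert_subset_iff, hx, hx']
  have adjoin_le : Subalgebra.toSubmodule (StarAlgebra.adjoin 𝕜 {x}).toSubalgebra ≤
      Submodule.span 𝕜 (M : Set A) := by
    rw [StarAlgebra.adjoin_eq_span]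
    exact Submodule.span_mono words_le
  exact closure_mono adjoin_le

namespace Toeplitz

theorem tmul_mul_tmul (A B C D : Toep) : tmul A B * tmul C D = tmul (A * C) (B * D) :=
  MinTensor.val_ext (opTensor_mul A.val B.val C.val D.val).symm

theorem star_tmul (A B : Toep) : star (tmul A B) = tmul (star A) (star B) :=
  MinTensor.val_ext (opTensor_star A.val B.val)

theorem tmul_one_one : tmul 1 1 = 1 :=
  MinTensor.val_ext opTensor_one

/-- The monoid of group-like elements of the Toeplitz algebra, those with `Δ A = A ⊗ A`. The element
`0` also satisfies this equation and is not excluded. -/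
def groupLike : Submonoid Toep where
  carrier := {A | comul A = tmul A A}
  one_mem' := (map_one comul).trans tmul_one_one.symm
  mul_mem' {A B} (hA : comul A = tmul A A) (hB : comul B = tmul B B) :=
    show comul (A * B) = tmul (A * B) (A * B) by rw [map_mul, hA, hB, tmul_mul_tmul]

theorem mem_groupLike {A : Toep} : A ∈ groupLike ↔ comul A = tmul A A := Iff.rfl

theorem T_mem_groupLike : T ∈ groupLike := comul_T

theorem star_mem_groupLike {A : Toep} (hA : A ∈ groupLike) : star A ∈ groupLike := by
  rw [mem_groupLike] at hA ⊢
  rw [map_star, hA, star_tmul]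

theorem dense_span_groupLike : Dense (Submodule.span ℂ (groupLike : Set Toep) : Set Toep) := by
  have shift_mem : shift ∈ groupLike.map Toep.val := ⟨T, T_mem_groupLike, rfl⟩
  have star_shift_mem : star shift ∈ groupLike.map Toep.val :=
    ⟨star T, star_mem_groupLike T_mem_groupLike, rfl⟩
  have span_map : (Submodule.span ℂ (groupLike.map Toep.val : Set (L2 →L[ℂ] L2)) :
      Set (L2 →L[ℂ] L2)) = Toep.val '' Submodule.span ℂ (groupLike : Set Toep) :=
    congrArg SetLike.coe (Submodule.map_span (Toep.val : Toep →ₗ[ℂ] L2 →L[ℂ] L2) groupLike).symm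
  have toeplitz_subset := coe_elemental_subset_closure_span (𝕜 := ℂ) shift_mem star_shift_mem
  rw [span_map] at toeplitz_subset
  exact Subtype.dense_iff.2 toeplitz_subset

/-- Restriction of functionals to the group-like elements, as a linear map into the algebra of all
complex functions on them with pointwise multiplication. -/
noncomputable def restrictGroupLike : StrongDual ℂ Toep →ₗ[ℂ] groupLike → ℂ where
  toFun ρ A := ρ A
  map_add' _ _ := rfl
  map_smul' _ _ := rfl

theorem restrictGroupLike_injective : Function.Injective restrictGroupLike := fun _ _ h =>
  ContinuousLinearMap.ext_on dense_span_groupLike fun A hA => congrFun h ⟨A, hA⟩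

theorem restrictGroupLike_convolution (ρ φ : StrongDual ℂ Toep) :
    restrictGroupLike (convolution ρ φ) = restrictGroupLike ρ * restrictGroupLike φ := by
  ext ⟨A, hA⟩
  change tensorFunctional ρ φ (comul A) = ρ A * φ A
  rw [mem_groupLike.1 hA, tensorFunctional_tmul]

theorem extendOfNorm_algFunctional (ρ φ : StrongDual ℂ Toep) :
    (algFunctional ρ φ).extendOfNorm ofAlgTensor = tensorFunctional ρ φ :=
  LinearMap.extendOfNorm_unique denseRange_ofAlgTensor _ (norm_algFunctional_le ρ φ) _ <|
    TensorProduct.ext' (tensorFunctional_tmul ρ φ)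

theorem norm_tensorFunctional_le (ρ φ : StrongDual ℂ Toep) :
    ‖tensorFunctional ρ φ‖ ≤ ‖ρ‖ * ‖φ‖ := by
  rw [← extendOfNorm_algFunctional]
  exact LinearMap.opNorm_extendOfNorm_le denseRange_ofAlgTensor (by positivity)
    (norm_algFunctional_le ρ φ)

theorem norm_convolution_le (ρ φ : StrongDual ℂ Toep) : ‖convolution ρ φ‖ ≤ ‖ρ‖ * ‖φ‖ := by
  refine ContinuousLinearMap.opNorm_le_bound _ (by positivity) fun A => ?_
  calc ‖tensorFunctional ρ φ (comul A)‖
      ≤ ‖tensorFunctional ρ φ‖ * ‖comul A‖ := (tensorFunctional ρ φ).le_opNorm _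
    _ ≤ ‖ρ‖ * ‖φ‖ * ‖A‖ := by
      gcongr
      · exact norm_tensorFunctional_le ρ φ
      · exact NonUnitalStarAlgHom.norm_apply_le comul A

end Toeplitz

theorem theorem7 :
    IsCommBanachAlgebra (StrongDual ℂ Toeplitz.Toep) Toeplitz.convolution :=
  .of_injective Toeplitz.restrictGroupLike Toeplitz.restrictGroupLike_injective
    Toeplitz.restrictGroupLike_convolution Toeplitz.norm_convolution_le
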